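/- Hypothesis classes are sets $H$ of functions $\mathbb{N}\to\{0,1\}$, and a sample is a finite sequence of pairs from $\mathbb{N}\times\{0,1\}$. A sample $(x_1,y_1)\ldots(x_k,y_k)$ is $H$-realizable if some $f\in H$ satisfies $f(x_1)=y_1,\ldots,f(x_k)=y_k$. A Littlestone tree of depth $d$ is a complete rooted binary tree of depth $d$ whose non-leaf nodes are labelled by natural numbers and in which every non-leaf node has one outgoing edge labelled $0$ and one outgoing edge labelled $1$. Each leaf determines the sample read on the path from the root to it, in which an edge with label $y$ that starts at a node with label $x$ contributes the pair $(x,y)$; the leaf is $H$-realizable if this sample is. The effective Littlestone dimension $\mathrm{eldim}(H)$ is the minimal $d\ge 0$ for which there is a total Turing machine that, given a Littlestone tree of depth $d+1$, outputs a leaf of it which is not $H$-realizable; $\mathrm{eldim}(H)=\infty$ if there is no such $d$. For $(x_1,\ldots,x_t)\in\mathbb{N}^t$ and $1\le i\le t$, the $i$th threshold on $(x_1,\ldots,x_t)$ is the sample $(x_1,0)\ldots(x_{i-1},0)(x_i,1)\ldots(x_t,1)$. The effective threshold dimension $\mathrm{etdim}(H)$ is the minimal $t\ge 0$ for which there is a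 total Turing machine that, given $(x_1,\ldots,x_{t+1})\in\mathbb{N}^{t+1}$, outputs some $i\in\{1,\ldots,t+1\}$ such that the $i$th threshold on $(x_1,\ldots,x_{t+1})$ is not $H$-realizable; $\mathrm{etdim}(H)=\infty$ if there is no such $t$. Corollary. For every hypothesis class $H$, with the conventions $\lfloor\log_2\infty\rfloor=\infty$ and $\lfloor\log_2 0\rfloor=0$: 1. $\lfloor\log_2\mathrm{eldim}(H)\rfloor\le\mathrm{etdim}(H)$; 2. $\lfloor\log_2\mathrm{etdim}(H)\rfloor\le\mathrm{eldim}(H)$. In particular, $\mathrm{eldim}(H)$ is finite if and only if $\mathrm{etdim}(H)$ is finite. -/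

import Mathlib

/-! Hypothesis classes are sets `H : Set (ℕ → Bool)` of functions from `ℕ` to `{0, 1}`, with
`false` for `0` and `true` for `1`.  Samples are finite sequences in `ℕ × {0, 1}`. -/

/-- The sample `S` is consistent with the function `f`. -/
def Consistent (S : List (ℕ × Bool)) (f : ℕ → Bool) : Prop :=
  ∀ p ∈ S, f p.1 = p.2

/-- The sample `S` is `H`-realizable. -/
def Realizable (H : Set (ℕ → Bool)) (S : List (ℕ × Bool)) : Prop :=
  ∃ f ∈ H, Consistent S f

/-- Littlestone trees of depth `d`: a tree of depth `0` is a single (unlabelled) leaf, and a tree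
`(x, T₀, T₁)` of depth `d + 1` consists of the label `x` of the root, the subtree `T₀` below the
0-edge of the root and the subtree `T₁` below the 1-edge of the root. -/
def LittlestoneTree : ℕ → Type
  | 0 => Unit
  | d + 1 => ℕ × LittlestoneTree d × LittlestoneTree d

/-- Littlestone trees as finite inputs of an algorithm, coded as nested tuples of numbers. -/
instance LittlestoneTree.instPrimcodable : (d : ℕ) → Primcodable (LittlestoneTree d)
  | 0 => inferInstanceAs (Primcodable Unit)
  | d + 1 =>
    haveI := LittlestoneTree.instPrimcodable d
    inferInstanceAs (Primcodable (ℕ × LittlestoneTree d × LittlestoneTree d))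

/-- A leaf of a tree of depth `d` is the sequence `v` of the `d` edge labels on the way from the
root to it.  This is the sample written on that path. -/
def LittlestoneTree.sample : (d : ℕ) → LittlestoneTree d → (Fin d → Bool) → List (ℕ × Bool)
  | 0, _, _ => []
  | d + 1, (x, T₀, T₁), v =>
    (x, v 0) :: LittlestoneTree.sample d (if v 0 = true then T₁ else T₀) (Fin.tail v)

/-- The `i`th threshold `(x₁, 0) … (xᵢ₋₁, 0) (xᵢ, 1) … (xₜ, 1)` on `(x₁, …, xₜ)`.
Indices start at `0` here. -/
def threshold {t : ℕ} (x : Fin t → ℕ) (i : Fin t) : List (ℕ × Bool) :=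
  List.ofFn fun j => (x j, decide (i ≤ j))

/-- Some total computable function maps each Littlestone tree of depth `d + 1` to a leaf of it
that is not `H`-realizable. -/
def HasEffectiveLittlestoneBound (H : Set (ℕ → Bool)) (d : ℕ) : Prop :=
  ∃ A : LittlestoneTree (d + 1) → (Fin (d + 1) → Bool), Computable A ∧
    ∀ T, ¬ Realizable H (LittlestoneTree.sample (d + 1) T (A T))

/-- Some total computable function maps each `(x₁, …, xₜ₊₁)` to an index `i` for which the `i`th
threshold on this sequence is not `H`-realizable. -/
def HasEffectiveThresholdBound (H : Set (ℕ → Bool)) (t : ℕ) : Prop :=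
  ∃ w : (Fin (t + 1) → ℕ) → Fin (t + 1), Computable w ∧
    ∀ x, ¬ Realizable H (threshold x (w x))

/-- The effective Littlestone dimension: the minimal `d` as above, `⊤` if there is none. -/
noncomputable def eldim (H : Set (ℕ → Bool)) : ℕ∞ :=
  ⨅ (d : ℕ) (_ : HasEffectiveLittlestoneBound H d), (d : ℕ∞)

/-- The effective threshold dimension: the minimal `t` as above, `⊤` if there is none. -/
noncomputable def etdim (H : Set (ℕ → Bool)) : ℕ∞ :=
  ⨅ (t : ℕ) (_ : HasEffectiveThresholdBound H t), (t : ℕ∞)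

/-- `⌊log₂ n⌋` for `n ≥ 1`, extended by `⊤ ↦ ⊤` and `0 ↦ 0`. -/
def floorLogTwo (n : ℕ∞) : ℕ∞ :=
  n.map (Nat.log 2)

/-! ### Thresholds in shattered trees -/

/-! Each search problem is reduced to the other at an exponential cost. A tuple of length `2 ^ (d +
1)` yields a binary search tree of depth `d + 1`. Its leaves correspond to the thresholds and each
leaf's sample is part of its threshold, so a non-realizable leaf gives a non-realizable threshold
(`mem_sample_searchTree`). Conversely, run the threshold algorithm on all tuples of node labels of a
tree of depth `2 ^ (t + 1)`. If along every path some function avoided all selected thresholds,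
these functions would shatter the tree, and a Ramsey argument (`Shatters.exists_thresholds`) would
make them realize every threshold on some tuple. So some leaf forces a selected threshold
(`exists_leaf_of_selection`). It depends only on the finite table of answers, hence is found by
lookup. -/

/-- `F` shatters some complete binary tree of depth `d` with node labels in `X`. -/
def Shatters {ι : Type*} (X : Set ι) : ℕ → Set (ι → Bool) → Prop
  | 0, F => F.Nonempty
  | d + 1, F => ∃ x ∈ X, ∀ b, Shatters X d {f ∈ F | f x = b}

namespace Shatters

variable {ι : Type*} {X : Set ι}

theorem mono_class {d : ℕ} {F G : Set (ι → Bool)} (hFG : F ⊆ G) (h : Shatters X d F) :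
    Shatters X d G := by
  induction d generalizing F G with
  | zero => exact Set.Nonempty.mono hFG h
  | succ d ih =>
    obtain ⟨x, hx, hb⟩ := h
    exact ⟨x, hx, fun b => ih (fun f hf => ⟨hFG hf.1, hf.2⟩) (hb b)⟩

theorem of_succ {d : ℕ} {F : Set (ι → Bool)} (h : Shatters X (d + 1) F) : Shatters X d F := by
  obtain ⟨x, -, hb⟩ := h
  exact (hb true).mono_class fun f hf => hf.1

theorem nonempty {d : ℕ} {F : Set (ι → Bool)} (h : Shatters X d F) : F.Nonempty := by
  induction d with
  | zero => exact h
  | succ d ih => exact ih h.of_succ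

/-- If the nodes of a shattered tree of depth `a + b` are coloured by `h`, then there is a
shattered monochromatic tree of depth `a` (colour `true`) or `b` (colour `false`). -/
theorem monochromatic (h : ι → Bool) {a b : ℕ} {F : Set (ι → Bool)}
    (hF : Shatters X (a + b) F) :
    Shatters {x ∈ X | h x = true} a F ∨ Shatters {x ∈ X | h x = false} b F := by
  induction n : a + b generalizing a b F with
  | zero =>
    obtain rfl : a = 0 := by omega
    exact Or.inl hF.nonempty
  | succ n ih =>
    rcases a with _ | a
    · exact Or.inl hF.nonempty
    rcases b with _ | b
    · exact Or.inr hF.nonempty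
    have hF' := hF
    rw [show a + 1 + (b + 1) = (a + b + 1) + 1 by omega] at hF'
    obtain ⟨x, hx, hc⟩ := hF'
    have hsub : ∀ c, {f ∈ F | f x = c} ⊆ F := fun c f hf => hf.1
    cases hhx : h x with
    | true =>
      have key : ∀ c, Shatters {x ∈ X | h x = true} a {f ∈ F | f x = c} ∨
          Shatters {x ∈ X | h x = false} (b + 1) {f ∈ F | f x = c} := fun c =>
        ih (by simpa [add_assoc] using hc c) (by omega)
      -- A `false` tree below either edge suffices; otherwise the root joins the `true` trees of
      -- both sides.
      by_cases hr : ∃ c, Shatters {x ∈ X | h x = false} (b + 1) {f ∈ F | f x = c}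
      · obtain ⟨c, hr⟩ := hr
        exact Or.inr (hr.mono_class (hsub c))
      · exact Or.inl ⟨x, ⟨hx, hhx⟩, fun c => (key c).resolve_right fun hh => hr ⟨c, hh⟩⟩
    | false =>
      have key : ∀ c, Shatters {x ∈ X | h x = true} (a + 1) {f ∈ F | f x = c} ∨
          Shatters {x ∈ X | h x = false} b {f ∈ F | f x = c} := fun c =>
        ih (by simpa [add_assoc, add_comm, add_left_comm] using hc c) (by omega)
      by_cases hr : ∃ c, Shatters {x ∈ X | h x = true} (a + 1) {f ∈ F | f x = c}
      · obtain ⟨c, hr⟩ := hr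
        exact Or.inl (hr.mono_class (hsub c))
      · exact Or.inr ⟨x, ⟨hx, hhx⟩, fun c => (key c).resolve_left fun hh => hr ⟨c, hh⟩⟩

/-- A class that shatters a tree of depth `2 ^ (k + 1) - 2` contains all `k + 1` monotone patterns
on some `k` node labels. -/
theorem exists_thresholds {k : ℕ} {F : Set (ι → Bool)} (hF : Shatters X (2 ^ (k + 1) - 2) F) :
    ∃ x : Fin k → ι, (∀ j, x j ∈ X) ∧
      ∀ i : ℕ, ∃ f ∈ F, ∀ j : Fin k, f (x j) = decide (i ≤ (j : ℕ)) := by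
  induction k generalizing X F with
  | zero =>
    obtain ⟨f, hf⟩ := hF.nonempty
    exact ⟨Fin.elim0, fun j => j.elim0, fun _ => ⟨f, hf, fun j => j.elim0⟩⟩
  | succ k ih =>
    -- Colour the nodes by one member `h`. On a monochromatic tree `h` supplies a constant pattern;
    -- the others come from below its root.
    obtain ⟨h, hh⟩ := hF.nonempty
    have hpow : 2 ^ (k + 1 + 1) - 2 = (2 ^ (k + 1) - 2 + 1) + (2 ^ (k + 1) - 2 + 1) := by
      have : 2 ≤ 2 ^ (k + 1) := by
        rw [pow_succ]; have := Nat.one_le_two_pow (n := k); omega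
      rw [pow_succ 2 (k + 1)]; omega
    rw [hpow] at hF
    rcases hF.monochromatic h with ⟨x, hx, hb⟩ | ⟨x, hx, hb⟩
    -- `h` is constantly `true`: the root goes first with value `false`, and `h` serves `i = 0`.
    · obtain ⟨y, hy, hf⟩ := ih (hb false)
      refine ⟨Fin.cons x y, Fin.cases hx.1 fun j => (hy j).1, fun i => ?_⟩
      rcases i with _ | i
      · refine ⟨h, hh, Fin.cases ?_ fun j => ?_⟩
        · simpa using hx.2
        · simpa using (hy j).2
      · obtain ⟨f, hfF, hfy⟩ := hf i
        refine ⟨f, hfF.1, Fin.cases ?_ fun j => ?_⟩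
        · simpa using hfF.2
        · simpa using hfy j
    -- `h` is constantly `false`: the root goes last with value `true`, and `h` serves `i > k`.
    · obtain ⟨y, hy, hf⟩ := ih (hb true)
      refine ⟨Fin.snoc (α := fun _ => ι) y x, fun j => ?_, fun i => ?_⟩
      · refine Fin.lastCases ?_ (fun j => ?_) j
        · simpa using hx.1
        · simpa using (hy j).1
      by_cases hi : i ≤ k
      · obtain ⟨f, hfF, hfy⟩ := hf i
        refine ⟨f, hfF.1, Fin.lastCases ?_ fun j => ?_⟩
        · simpa [hi] using hfF.2
        · simpa using hfy j
      · refine ⟨h, hh, Fin.lastCases ?_ fun j => ?_⟩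
        · simpa [hi] using hx.2
        · have := j.isLt
          have hij : ¬ i ≤ (j : ℕ) := by omega
          simpa [hij] using (hy j).2

end Shatters

/-- The values of `g` at the nodes on the path `v` are the edge labels of that path.  Nodes are
given by the list of edge labels leading to them. -/
def FollowsPath : (d : ℕ) → (List Bool → Bool) → (Fin d → Bool) → Prop
  | 0, _, _ => True
  | d + 1, g, v => g [] = v 0 ∧ FollowsPath d (fun p => g (v 0 :: p)) (Fin.tail v)

theorem shatters_of_followsPath {ι : Type*} {X : Set ι} {d : ℕ} {e : List Bool → ι}
    {F : Set (ι → Bool)} (he : ∀ p, p.length < d → e p ∈ X)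
    (h : ∀ v, ∃ f ∈ F, FollowsPath d (fun p => f (e p)) v) : Shatters X d F := by
  induction d generalizing e F with
  | zero =>
    obtain ⟨f, hf, -⟩ := h Fin.elim0
    exact ⟨f, hf⟩
  | succ d ih =>
    refine ⟨e [], he [] (by simp), fun b => ih (e := fun p => e (b :: p))
      (fun p hp => he _ (by simpa using hp)) fun v => ?_⟩
    obtain ⟨f, hf, h0, h1⟩ := h (Fin.cons b v)
    exact ⟨f, ⟨hf, by simpa using h0⟩, by simpa using h1⟩

/-- However a threshold is selected for each tuple of nodes of the complete binary tree of depth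
`2 ^ (t + 1)`, here written `d + 1`, there is a leaf such that each function compatible with it
realizes one of the selected thresholds. -/
theorem exists_leaf_of_selection {t d : ℕ} (hd : d = 2 ^ (t + 1) - 2 + 1)
    (W : (Fin (t + 1) → {p : List Bool // p.length < d + 1}) → Fin (t + 1)) :
    ∃ v : Fin (d + 1) → Bool, ∀ g : List Bool → Bool, FollowsPath _ g v →
      ∃ s, ∀ j, g (s j) = decide (W s ≤ j) := by
  by_contra! hcon
  obtain ⟨x, hx, hb⟩ := shatters_of_followsPath (e := fun p => p)
    (X := {p : List Bool | p.length < d + 1})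
    (F := {g | ∀ s, ∃ j, g (s j) ≠ decide (W s ≤ j)}) (fun p hp => hp)
    (fun v => by
      obtain ⟨g, hg, hs⟩ := hcon v
      exact ⟨g, hs, hg⟩)
  have hsh := hb true
  rw [show Shatters _ d = Shatters _ (2 ^ (t + 1) - 2 + 1) from congrArg _ hd] at hsh
  -- One level is spare; the resulting bound `2 ^ (t + 1) - 1` still has floored logarithm `t`.
  obtain ⟨y, hy, hf⟩ := hsh.of_succ.exists_thresholds
  -- Every threshold ends in `1`, so the root, left along its 1-edge, can be the last node.
  let s : Fin (t + 1) → {p : List Bool // p.length < d + 1} :=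
    Fin.snoc (α := fun _ => _) (fun j => ⟨y j, hy j⟩) ⟨x, hx⟩
  obtain ⟨f, hfF, hfy⟩ := hf (W s)
  obtain ⟨j, hj⟩ := hfF.1 s
  refine hj ?_
  refine Fin.lastCases ?_ (fun j => ?_) j
  · simpa [s, Fin.le_last] using hfF.2
  · simpa [s, Fin.le_def] using hfy j

/-! ### Effective Littlestone bounds from effective threshold bounds -/

namespace LittlestoneTree

/-- The label of the node at the end of a path, `0` if there is no such node. -/
def label : (d : ℕ) → LittlestoneTree d → List Bool → ℕ
  | 0, _, _ => 0
  | _ + 1, (x, _, _), [] => x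
  | d + 1, (_, T₀, T₁), b :: p => label d (if b = true then T₁ else T₀) p

theorem primrec_root (d : ℕ) : Primrec fun T : LittlestoneTree (d + 1) => (T.1 : ℕ) :=
  (Primrec.fst : Primrec (Prod.fst : ℕ × LittlestoneTree d × LittlestoneTree d → ℕ))

theorem primrec_left (d : ℕ) :
    Primrec fun T : LittlestoneTree (d + 1) => (T.2.1 : LittlestoneTree d) :=
  (Primrec.fst.comp Primrec.snd :
    Primrec fun T : ℕ × LittlestoneTree d × LittlestoneTree d => T.2.1)

theorem primrec_right (d : ℕ) :
    Primrec fun T : LittlestoneTree (d + 1) => (T.2.2 : LittlestoneTree d) :=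
  (Primrec.snd.comp Primrec.snd :
    Primrec fun T : ℕ × LittlestoneTree d × LittlestoneTree d => T.2.2)

theorem primrec_node {α : Type*} [Primcodable α] {d : ℕ} {x : α → ℕ}
    {T₀ T₁ : α → LittlestoneTree d} (hx : Primrec x) (h₀ : Primrec T₀) (h₁ : Primrec T₁) :
    Primrec fun a => ((x a, T₀ a, T₁ a) : LittlestoneTree (d + 1)) :=
  (hx.pair (h₀.pair h₁) :
    Primrec fun a => ((x a, T₀ a, T₁ a) : ℕ × LittlestoneTree d × LittlestoneTree d))

theorem primrec_label (d : ℕ) (p : List Bool) : Primrec fun T => label d T p := by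
  induction d generalizing p with
  | zero => exact Primrec.const 0
  | succ d ih =>
    rcases p with _ | ⟨b, p⟩
    · exact primrec_root d
    · cases b
      · exact (ih p).comp (primrec_left d)
      · exact (ih p).comp (primrec_right d)

/-- Pulling `f` back from labels to nodes makes repeated labels harmless. -/
theorem followsPath_of_consistent {d : ℕ} {T : LittlestoneTree d} {v : Fin d → Bool}
    {f : ℕ → Bool} (h : Consistent (sample d T v) f) :
    FollowsPath d (fun p => f (label d T p)) v := by
  induction d with
  | zero => trivial
  | succ d ih =>
    obtain ⟨x, T₀, T₁⟩ := T
    exact ⟨h _ List.mem_cons_self, ih fun p hp => h p (List.mem_cons_of_mem _ hp)⟩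

end LittlestoneTree

theorem Computable.fin_pi {α σ : Type*} [Primcodable α] [Primcodable σ] {n : ℕ}
    {f : Fin n → α → σ} (hf : ∀ i, Computable (f i)) : Computable fun a i => f i a := by
  have h : Computable fun a => (List.Vector.ofFn fun i => f i a).get :=
    (Primrec.vector_get'.to_comp).comp (Computable.vector_ofFn hf)
  exact h.of_eq fun a => funext fun i => by simp

/-- Finitely many computable finite-valued functions can be postprocessed arbitrarily. -/
theorem Computable.of_finite_table {α β ι σ : Type*} [Primcodable α] [Primcodable β]
    [Primcodable σ] [Finite ι] [Finite β] {φ : ι → α → β} (hφ : ∀ i, Computable (φ i))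
    (G : (ι → β) → σ) : Computable fun a => G fun i => φ i a := by
  obtain ⟨n, ⟨e⟩⟩ := Finite.exists_equiv_fin ι
  have h := (Primrec.dom_finite fun u : Fin n → β => G fun i => u (e i)).to_comp.comp
    (Computable.fin_pi fun j => hφ (e.symm j))
  exact h.of_eq fun a => by simp

theorem LittlestoneTree.computable_of_labels {σ ι : Type*} [Primcodable σ] [Finite ι] {d k m : ℕ}
    {w : (Fin k → ℕ) → Fin m} (hw : Computable w) (s : ι → Fin k → List Bool)
    (G : (ι → Fin m) → σ) :
    Computable fun T : LittlestoneTree d => G fun i => w fun j => label d T (s i j) :=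
  Computable.of_finite_table (fun i => hw.comp
    (Computable.fin_pi fun j => (primrec_label d (s i j)).to_comp)) G

theorem HasEffectiveThresholdBound.littlestone {H : Set (ℕ → Bool)} {t d : ℕ}
    (hd : d = 2 ^ (t + 1) - 2 + 1) (h : HasEffectiveThresholdBound H t) :
    HasEffectiveLittlestoneBound H d := by
  obtain ⟨w, hw, hH⟩ := h
  -- `G` is chosen non-constructively, but as a fixed function on a finite set it is computable.
  choose G hG using exists_leaf_of_selection hd
  have : Finite {p : List Bool // p.length < d + 1} :=
    (List.finite_length_lt Bool _).to_subtype
  refine ⟨fun T => G fun s => w fun j => LittlestoneTree.label _ T (s j), ?_, fun T => ?_⟩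
  · exact LittlestoneTree.computable_of_labels (d := d + 1) hw
      (fun (s : Fin (t + 1) → {p : List Bool // p.length < d + 1}) j => (s j : List Bool)) G
  · rintro ⟨f, hfH, hf⟩
    obtain ⟨s, hs⟩ := hG _ _ (LittlestoneTree.followsPath_of_consistent hf)
    refine hH (fun j => LittlestoneTree.label _ T (s j)) ⟨f, hfH, fun p hp => ?_⟩
    obtain ⟨j, rfl⟩ := List.mem_ofFn.1 hp
    exact hs j

/-! ### Effective threshold bounds from effective Littlestone bounds -/

/-- The tree of binary search for a threshold among the indices `o, …, o + 2 ^ m - 1`. -/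
def searchTree (x : ℕ → ℕ) : (m : ℕ) → ℕ → LittlestoneTree m
  | 0, _ => ()
  | m + 1, o => (x (o + 2 ^ m - 1), searchTree x m (o + 2 ^ m), searchTree x m o)

/-- The index found at a leaf of `searchTree`. -/
def searchIndex : (m : ℕ) → ℕ → (Fin m → Bool) → ℕ
  | 0, o, _ => o
  | m + 1, o, v => searchIndex m (if v 0 = true then o else o + 2 ^ m) (Fin.tail v)

theorem searchIndex_mem_Ico (m o : ℕ) (v : Fin m → Bool) :
    searchIndex m o v ∈ Set.Ico o (o + 2 ^ m) := by
  induction m generalizing o with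
  | zero => simp [searchIndex]
  | succ m ih =>
    have := ih (if v 0 = true then o else o + 2 ^ m) (Fin.tail v)
    rw [searchIndex, pow_succ]
    simp only [Set.mem_Ico] at this ⊢
    split_ifs at this ⊢ <;> omega

/-- The search never leaves the half it has chosen, so the index finally found agrees with every
earlier comparison. -/
theorem mem_sample_searchTree {x : ℕ → ℕ} {m o : ℕ} {v : Fin m → Bool} {p : ℕ × Bool}
    (hp : p ∈ LittlestoneTree.sample m (searchTree x m o) v) :
    ∃ j < o + 2 ^ m, p = (x j, decide (searchIndex m o v ≤ j)) := by
  induction m generalizing o with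
  | zero => simp [LittlestoneTree.sample] at hp
  | succ m ih =>
    have hpos := Nat.one_le_two_pow (n := m)
    rcases List.mem_cons.1 hp with rfl | hp
    · refine ⟨o + 2 ^ m - 1, by rw [pow_succ]; omega, ?_⟩
      have := searchIndex_mem_Ico m (if v 0 = true then o else o + 2 ^ m) (Fin.tail v)
      rw [Set.mem_Ico] at this
      rw [searchIndex]
      cases hv : v 0
      · simp only [hv, Bool.false_eq_true, if_false] at this ⊢
        rw [decide_eq_false (by omega)]
      · simp only [hv, if_true] at this ⊢
        rw [decide_eq_true (by omega)]
    · rw [searchIndex]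
      cases hv : v 0
      · simp only [hv, Bool.false_eq_true, if_false] at hp ⊢
        obtain ⟨j, hj, h⟩ := ih hp
        exact ⟨j, by rw [pow_succ]; omega, h⟩
      · simp only [hv, if_true] at hp ⊢
        obtain ⟨j, hj, h⟩ := ih hp
        exact ⟨j, by rw [pow_succ]; omega, h⟩

theorem primrec_searchTree {α : Type*} [Primcodable α] {x : α → ℕ → ℕ}
    (hx : ∀ j, Primrec fun a => x a j) (m o : ℕ) : Primrec fun a => searchTree (x a) m o := by
  induction m generalizing o with
  | zero => exact Primrec.const (() : Unit)
  | succ m ih => exact LittlestoneTree.primrec_node (hx _) (ih _) (ih _)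

theorem HasEffectiveLittlestoneBound.threshold {H : Set (ℕ → Bool)} {d : ℕ}
    (h : HasEffectiveLittlestoneBound H d) : HasEffectiveThresholdBound H (2 ^ (d + 1) - 1) := by
  obtain ⟨A, hA, hH⟩ := h
  have hpow : 2 ^ (d + 1) = 2 ^ (d + 1) - 1 + 1 := by
    have := Nat.one_le_two_pow (n := d + 1)
    omega
  have hlt : ∀ v : Fin (d + 1) → Bool, searchIndex (d + 1) 0 v < 2 ^ (d + 1) - 1 + 1 := fun v => by
    have := (searchIndex_mem_Ico (d + 1) 0 v).2
    omega
  -- The default `0` is never read: the search tree only uses positions below `2 ^ (d + 1)`.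
  let ext : (Fin (2 ^ (d + 1) - 1 + 1) → ℕ) → ℕ → ℕ := fun x j =>
    if hj : j < 2 ^ (d + 1) - 1 + 1 then x ⟨j, hj⟩ else 0
  have hext : ∀ j, Primrec fun x => ext x j := fun j => by
    by_cases hj : j < 2 ^ (d + 1) - 1 + 1
    · simpa only [ext, hj, dif_pos, id] using
        Primrec.fin_app.comp Primrec.id (Primrec.const ⟨j, hj⟩)
    · simpa only [ext, hj, dif_neg, not_false_eq_true] using Primrec.const 0
  refine ⟨fun x => ⟨_, hlt (A (searchTree (ext x) (d + 1) 0))⟩, ?_, fun x => ?_⟩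
  · exact (Primrec.dom_finite fun v => (⟨_, hlt v⟩ : Fin (2 ^ (d + 1) - 1 + 1))).to_comp.comp
      (hA.comp (primrec_searchTree hext (d + 1) 0).to_comp)
  · rintro ⟨f, hfH, hf⟩
    refine hH (searchTree (ext x) (d + 1) 0) ⟨f, hfH, fun p hp => ?_⟩
    obtain ⟨j, hj, rfl⟩ := mem_sample_searchTree hp
    have hj' : j < 2 ^ (d + 1) - 1 + 1 := by omega
    have := hf _ (List.mem_ofFn.2 ⟨⟨j, hj'⟩, rfl⟩)
    simpa only [ext, hj', dif_pos, Fin.le_def] using this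

/-! ### The dimensions -/

theorem iInf_natCast_eq_top_or_exists (P : ℕ → Prop) :
    (⨅ (n : ℕ) (_ : P n), (n : ℕ∞)) = ⊤ ∨ ∃ n, P n ∧ (⨅ (n : ℕ) (_ : P n), (n : ℕ∞)) = n := by
  classical
  by_cases h : ∃ n, P n
  · refine Or.inr ⟨Nat.find h, Nat.find_spec h, le_antisymm (iInf₂_le _ (Nat.find_spec h)) ?_⟩
    exact le_iInf₂ fun n hn => by exact_mod_cast Nat.find_min' h hn
  · exact Or.inl (by simpa using h)

theorem floorLogTwo_le_of_le {n : ℕ∞} {k : ℕ} (h : n ≤ (2 ^ (k + 1) - 1 : ℕ)) :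
    floorLogTwo n ≤ k := by
  lift n to ℕ using ne_top_of_le_ne_top (ENat.natCast_ne_top _) h
  have hn : n ≤ 2 ^ (k + 1) - 1 := by exact_mod_cast h
  have hpos := Nat.one_le_two_pow (n := k + 1)
  have : Nat.log 2 n < k + 1 := Nat.log_lt_of_lt_pow' (by omega) (by omega)
  simp only [floorLogTwo, ENat.map_natCast]
  exact Nat.cast_le.2 (Nat.lt_succ_iff.1 this)

theorem mainTheorem7 (H : Set (ℕ → Bool)) :
    floorLogTwo (eldim H) ≤ etdim H ∧
    floorLogTwo (etdim H) ≤ eldim H ∧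
    (eldim H < ⊤ ↔ etdim H < ⊤) := by
  have hl : ∀ {t}, HasEffectiveThresholdBound H t → eldim H ≤ (2 ^ (t + 1) - 1 : ℕ) :=
    fun {t} ht => iInf₂_le _ <| ht.littlestone <| by
      have := Nat.one_le_two_pow (n := t)
      rw [pow_succ]; omega
  have ht : ∀ {d}, HasEffectiveLittlestoneBound H d → etdim H ≤ (2 ^ (d + 1) - 1 : ℕ) :=
    fun hd => iInf₂_le _ hd.threshold
  have el : eldim H = ⊤ ∨ ∃ d, HasEffectiveLittlestoneBound H d ∧ eldim H = d :=
    iInf_natCast_eq_top_or_exists _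
  have et : etdim H = ⊤ ∨ ∃ t, HasEffectiveThresholdBound H t ∧ etdim H = t :=
    iInf_natCast_eq_top_or_exists _
  refine ⟨?_, ?_, fun h => ?_, fun h => ?_⟩
  · rcases et with h | ⟨t, hb, h⟩
    · exact h ▸ le_top
    · exact h ▸ floorLogTwo_le_of_le (hl hb)
  · rcases el with h | ⟨d, hb, h⟩
    · exact h ▸ le_top
    · exact h ▸ floorLogTwo_le_of_le (ht hb)
  · obtain ⟨d, hb, -⟩ := el.resolve_left h.ne
    exact (ht hb).trans_lt (ENat.natCast_lt_top _)
  · obtain ⟨t, hb, -⟩ := et.resolve_left h.ne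
    exact (hl hb).trans_lt (ENat.natCast_lt_top _)
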